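/- Let $G$ be a six-dimensional real Lie group which is almost abelian, i.e. whose Lie algebra $\mathfrak g$ has an abelian ideal of codimension one. All structures below are left-invariant tensor fields on $G$. A Hermitian structure on $G$ is a pair $(J,g)$ of an integrable complex structure $J$ ($J^2=-\mathrm{Id}$, vanishing Nijenhuis tensor) and a Riemannian metric $g$ with $g(J\cdot,J\cdot)=g$; put $\omega(\cdot,\cdot)=g(J\cdot,\cdot)$ and $d^c\omega=-J\,d\omega=-d\omega(J\cdot,J\cdot,J\cdot)$. The structure $(J,g)$ is Kähler if $d\omega=0$. A generalized Kähler structure is a triple $(J_+,J_-,g)$ such that $(J_+,g)$ and $(J_-,g)$ are Hermitian structures satisfying $$d^c_+\omega_+ + d^c_-\omega_-=0,\qquad dd^c_+\omega_+=dd^c_-\omega_-=0 .$$ It is called split if $[J_+,J_-]=J_+J_--J_-J_+=0$, and non-split otherwise. Theorem. If $G$ admits no left-invariant Kähler structure, then $G$ admits no non-split left-invariant generalized Kähler structure. Hence every left-invariant generalized Kähler structure $(J_+,J_-,g)$ on $G$ satisfies $[J_+,J_-]=0$. -/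

import Mathlib

open scoped Manifold ContDiff

noncomputable section

namespace LieGeom

/-- A smooth real Lie group has the smoothness that Mathlib asks for to define its Lie algebra. -/
instance instLEInftyMinSmoothness : ENat.LEInfty (minSmoothness ℝ 3) :=
  ⟨by
    rw [minSmoothness_of_isRCLikeNormedField]
    exact WithTop.coe_le_coe.2 (le_top : (3 : ℕ∞) ≤ ⊤)⟩

variable {E : Type*} [NormedAddCommGroup E] [NormedSpace ℝ E]
  {H : Type*} [TopologicalSpace H] (I : ModelWithCorners ℝ E H)
  (G : Type*) [TopologicalSpace G] [ChartedSpace H G]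

/-- A (not necessarily smooth) vector field on `G`. -/
abbrev VField : Type _ := ∀ x : G, TangentSpace I x

/-- A field of endomorphisms of the tangent spaces of `G`. -/
abbrev EndField : Type _ := ∀ x : G, TangentSpace I x →ₗ[ℝ] TangentSpace I x

/-- A field of bilinear forms on the tangent spaces of `G`. -/
abbrev BilinField : Type _ :=
  ∀ x : G, TangentSpace I x →ₗ[ℝ] TangentSpace I x →ₗ[ℝ] ℝ

/-- A `2`-form, viewed as a function of two vector fields. -/
abbrev Form2 : Type _ := VField I G → VField I G → G → ℝ

/-- A `3`-form, viewed as a function of three vector fields. -/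
abbrev Form3 : Type _ := VField I G → VField I G → VField I G → G → ℝ

/-- A `4`-form, viewed as a function of four vector fields. -/
abbrev Form4 : Type _ :=
  VField I G → VField I G → VField I G → VField I G → G → ℝ

variable {I G}

/-- The vector field `X` is smooth, as a section of the tangent bundle. -/
def IsSmooth [IsManifold I 1 G] (X : VField I G) : Prop :=
  ContMDiff I I.tangent ∞ (fun x => (⟨x, X x⟩ : TangentBundle I G))

/-- The derivative `X f` of a function `f` along a vector field `X`. -/
def lieDer (X : VField I G) (f : G → ℝ) (x : G) : ℝ :=
  mfderiv I 𝓘(ℝ, ℝ) f x (X x)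

/-- The Lie bracket `[X, Y]` of vector fields. -/
def bracket (X Y : VField I G) : VField I G :=
  VectorField.mlieBracket I X Y

/-- The vector field `J X`. -/
def EndField.app (J : EndField I G) (X : VField I G) : VField I G :=
  fun x => J x (X x)

/-- The exterior derivative of a `2`-form (invariant formula). -/
def extDer2 (α : Form2 I G) : Form3 I G := fun X Y Z x =>
  lieDer X (α Y Z) x - lieDer Y (α X Z) x + lieDer Z (α X Y) x
    - α (bracket X Y) Z x + α (bracket X Z) Y x - α (bracket Y Z) X x

/-- The exterior derivative of a `3`-form (invariant formula). -/
def extDer3 (α : Form3 I G) : Form4 I G := fun X Y Z W x =>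
  lieDer X (α Y Z W) x - lieDer Y (α X Z W) x
    + lieDer Z (α X Y W) x - lieDer W (α X Y Z) x
    - α (bracket X Y) Z W x + α (bracket X Z) Y W x - α (bracket X W) Y Z x
    - α (bracket Y Z) X W x + α (bracket Y W) X Z x - α (bracket Z W) X Y x

/-- The Nijenhuis tensor of `J`, evaluated on two vector fields. -/
def nijenhuis (J : EndField I G) (X Y : VField I G) : VField I G :=
  bracket (J.app X) (J.app Y) - J.app (bracket (J.app X) Y)
    - J.app (bracket X (J.app Y)) - bracket X Y

/-- The fundamental form `ω(X, Y) = g(J X, Y)`. -/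
def fundForm (J : EndField I G) (g : BilinField I G) : Form2 I G :=
  fun X Y x => g x (J x (X x)) (Y x)

/-- The `3`-form `d^c ω = -J d J ω = -J d ω` of the fundamental form `ω` (for which `J ω = ω`),
where `J` acts on forms by `(J α)(X, Y, …) = α(J X, J Y, …)`. -/
def dcFundForm (J : EndField I G) (g : BilinField I G) : Form3 I G :=
  fun X Y Z x => -extDer2 (fundForm J g) (J.app X) (J.app Y) (J.app Z) x

section Group

variable [Group G] [LieGroup I ∞ G]

/-- Left-invariance of a field of endomorphisms: it commutes with the differentials of all the
left translations. Such a field on a Lie group is automatically smooth. -/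
def EndField.LeftInvariant (J : EndField I G) : Prop :=
  ∀ (a x : G) (v : TangentSpace I x),
    J (a * x) (mfderiv I I (fun y : G => a * y) x v)
      = mfderiv I I (fun y : G => a * y) x (J x v)

/-- Left-invariance of a field of bilinear forms: all the left translations preserve it.
Such a field on a Lie group is automatically smooth. -/
def BilinField.LeftInvariant (g : BilinField I G) : Prop :=
  ∀ (a x : G) (v w : TangentSpace I x),
    g (a * x) (mfderiv I I (fun y : G => a * y) x v) (mfderiv I I (fun y : G => a * y) x w)
      = g x v w

/-- `J` is a left-invariant (integrable) complex structure on `G`. -/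
structure IsLeftInvComplex (J : EndField I G) : Prop where
  leftInv : J.LeftInvariant
  sq : ∀ (x : G) (v : TangentSpace I x), J x (J x v) = -v
  integrable : ∀ X Y : VField I G, IsSmooth X → IsSmooth Y → nijenhuis J X Y = 0

/-- `g` is a left-invariant Riemannian metric on `G`. -/
structure IsLeftInvMetric (g : BilinField I G) : Prop where
  leftInv : g.LeftInvariant
  symm : ∀ (x : G) (v w : TangentSpace I x), g x v w = g x w v
  pos : ∀ (x : G) (v : TangentSpace I x), v ≠ 0 → 0 < g x v v

/-- `(J, g)` is a left-invariant Hermitian structure on `G`. -/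
structure IsLeftInvHermitian (J : EndField I G) (g : BilinField I G) : Prop where
  complex : IsLeftInvComplex J
  metric : IsLeftInvMetric g
  compat : ∀ (x : G) (v w : TangentSpace I x), g x (J x v) (J x w) = g x v w

/-- `(J, g)` is a left-invariant Kähler structure on `G`: it is Hermitian and `d ω = 0`. -/
structure IsLeftInvKahler (J : EndField I G) (g : BilinField I G) : Prop where
  hermitian : IsLeftInvHermitian J g
  closed : ∀ X Y Z : VField I G, IsSmooth X → IsSmooth Y → IsSmooth Z →
    extDer2 (fundForm J g) X Y Z = 0

/-- `(J, g)` is a left-invariant SKT structure on `G`: it is Hermitian and `d d^c ω = 0`. -/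
structure IsLeftInvSKT (J : EndField I G) (g : BilinField I G) : Prop where
  hermitian : IsLeftInvHermitian J g
  pluriclosed : ∀ X Y Z W : VField I G,
    IsSmooth X → IsSmooth Y → IsSmooth Z → IsSmooth W →
      extDer3 (dcFundForm J g) X Y Z W = 0

/-- `(J₊, J₋, g)` is a left-invariant generalized Kähler structure on `G`: a pair of SKT structures
with the same metric `g` and with opposite torsion, `d^c₊ ω₊ + d^c₋ ω₋ = 0`. -/
structure IsLeftInvGenKahler (Jp Jm : EndField I G) (g : BilinField I G) : Prop where
  skt_plus : IsLeftInvSKT Jp g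
  skt_minus : IsLeftInvSKT Jm g
  torsion : ∀ X Y Z : VField I G, IsSmooth X → IsSmooth Y → IsSmooth Z →
    dcFundForm Jp g X Y Z + dcFundForm Jm g X Y Z = 0

end Group

/-- The commutator `[J, K] = J K - K J` of two fields of endomorphisms. -/
def commutator (J K : EndField I G) : EndField I G :=
  fun x => J x ∘ₗ K x - K x ∘ₗ J x

variable (I G) in
/-- The Lie algebra of `G` has an abelian ideal of codimension one. -/
def IsAlmostAbelian [CompleteSpace E] [Group G] [LieGroup I ∞ G] : Prop :=
  ∃ 𝔥 : LieIdeal ℝ (GroupLieAlgebra I G), IsLieAbelian 𝔥 ∧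
    Module.finrank ℝ 𝔥 + 1 = Module.finrank ℝ (GroupLieAlgebra I G)

end LieGeom

end

/-! Everything reduces to the Lie algebra, with `n` a unit normal of the abelian ideal, A = ad `n`,
and S = `symmAd` the symmetrization of A. Integrability of `J` says that A preserves W = {`n`, `J
n`}^⊥ and commutes with `J` there. The torsion vanishes on (`J n`)^⊥, and its remaining components
are S(y, Jz) and g([n, Jn], y). Hence (J, g) is Kähler as soon as S = 0 on W and [n, Jn] ⟂ W
(`dform_eq_zero`).

For a generalized Kähler pair (J, K) put α = g(Jn, Kn). If α² < 1, comparing the two torsions gives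
S(y, Jz) = -α S(y, Kz) and the same with J, K exchanged, so S dies away from the span of `J n` and
`K n`. What is left is governed by u = Kn - α Jn and the numbers a_J = g(Jn, [n, Jn]), a_K = g(Kn,
[n, Kn]). The SKT conditions become (a_J + 2a_K) a_K = 0 = (a_K + 2a_J) a_J, so a_J = a_K = 0 and
(J, g) is Kähler (`dform_eq_zero_of_sq_lt_one`), in any dimension. If α² = 1, then Kn = ±Jn, and Kn
= Jn after a change of sign. Opposite torsion gives S(y, (J + K)z) = 0 on W. If J + K is invertible
on W, (J, g) is again Kähler. Otherwise Kw = -Jw for some w ≠ 0 in W, and [J, K] kills a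
4-dimensional space; in dimension six the remaining plane is too small for a nonzero commutator
(`comm_of_exists`). -/

namespace AlmostAbelian

/-! ### Hermitian structures on almost abelian Lie algebras. -/

variable {V : Type*} [LieRing V] [LieAlgebra ℝ V]

/-- The Chevalley–Eilenberg differential of the fundamental form `g (J ·) ·`. -/
def dform (g : V →ₗ[ℝ] V →ₗ[ℝ] ℝ) (J : V →ₗ[ℝ] V) (x y z : V) : ℝ :=
  -g (J ⁅x, y⁆) z + g (J ⁅x, z⁆) y - g (J ⁅y, z⁆) x

/-- The torsion `d^c ω` of a Hermitian structure on a Lie algebra. -/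
def torsion (g : V →ₗ[ℝ] V →ₗ[ℝ] ℝ) (J : V →ₗ[ℝ] V) (x y z : V) : ℝ :=
  -dform g J (J x) (J y) (J z)

/-- The Chevalley–Eilenberg differential of the torsion. -/
def dTorsion (g : V →ₗ[ℝ] V →ₗ[ℝ] ℝ) (J : V →ₗ[ℝ] V) (x y z w : V) : ℝ :=
  -torsion g J ⁅x, y⁆ z w + torsion g J ⁅x, z⁆ y w - torsion g J ⁅x, w⁆ y z
    - torsion g J ⁅y, z⁆ x w + torsion g J ⁅y, w⁆ x z - torsion g J ⁅z, w⁆ x y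

/-- `(J, g)` is a Hermitian structure on a Lie algebra, and `n` is a unit normal vector of an
abelian ideal of codimension one. -/
structure IsHermitianWithNormal (g : V →ₗ[ℝ] V →ₗ[ℝ] ℝ) (J : V →ₗ[ℝ] V) (n : V) : Prop where
  symm : ∀ x y, g x y = g y x
  pos : ∀ x, x ≠ 0 → 0 < g x x
  sq : ∀ x, J (J x) = -x
  compat : ∀ x y, g (J x) (J y) = g x y
  integrable : ∀ x y : V, ⁅J x, J y⁆ - J ⁅J x, y⁆ - J ⁅x, J y⁆ - ⁅x, y⁆ = 0
  unit : g n n = 1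
  comm : ∀ x y : V, g n x = 0 → g n y = 0 → ⁅x, y⁆ = 0
  ideal : ∀ x y : V, g n ⁅x, y⁆ = 0

/-- The symmetrization of `ad n` with respect to `g`. -/
def symmAd (g : V →ₗ[ℝ] V →ₗ[ℝ] ℝ) (n x y : V) : ℝ := g ⁅n, x⁆ y + g x ⁅n, y⁆

section Multilinear

variable (g : V →ₗ[ℝ] V →ₗ[ℝ] ℝ) (J : V →ₗ[ℝ] V) (n : V)

lemma dform_swap_left (x y z : V) : dform g J y x z = -dform g J x y z := by
  simp only [dform, ← lie_skew x y, map_neg, LinearMap.neg_apply]; ring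

lemma dform_swap_right (x y z : V) : dform g J x z y = -dform g J x y z := by
  simp only [dform, ← lie_skew y z, map_neg, LinearMap.neg_apply]; ring

lemma dform_add (x x' y z : V) : dform g J (x + x') y z = dform g J x y z + dform g J x' y z := by
  simp only [dform, add_lie, map_add, LinearMap.add_apply]; ring

lemma dform_smul (c : ℝ) (x y z : V) : dform g J (c • x) y z = c * dform g J x y z := by
  simp only [dform, smul_lie, map_smul, LinearMap.smul_apply, smul_eq_mul]; ring

lemma dform_add_mid (x y y' z : V) :
    dform g J x (y + y') z = dform g J x y z + dform g J x y' z := by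
  simp only [dform, lie_add, add_lie, map_add, LinearMap.add_apply]; ring

lemma dform_smul_mid (c : ℝ) (x y z : V) : dform g J x (c • y) z = c * dform g J x y z := by
  simp only [dform, lie_smul, smul_lie, map_smul, LinearMap.smul_apply, smul_eq_mul]; ring

lemma dform_add_right (x y z z' : V) :
    dform g J x y (z + z') = dform g J x y z + dform g J x y z' := by
  simp only [dform, lie_add, map_add, LinearMap.add_apply]; ring

lemma dform_smul_right (c : ℝ) (x y z : V) : dform g J x y (c • z) = c * dform g J x y z := by
  simp only [dform, lie_smul, map_smul, LinearMap.smul_apply, smul_eq_mul]; ring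

lemma torsion_swap_left (x y z : V) : torsion g J y x z = -torsion g J x y z := by
  simp only [torsion, dform_swap_left g J (J x) (J y)]

lemma torsion_swap_right (x y z : V) : torsion g J x z y = -torsion g J x y z := by
  simp only [torsion, dform_swap_right g J _ (J y) (J z)]

lemma torsion_add (x x' y z : V) :
    torsion g J (x + x') y z = torsion g J x y z + torsion g J x' y z := by
  simp only [torsion, map_add, dform_add]; ring

lemma torsion_smul (c : ℝ) (x y z : V) : torsion g J (c • x) y z = c * torsion g J x y z := by
  simp only [torsion, map_smul, dform_smul]; ring

lemma symmAd_add_left (x x' y : V) : symmAd g n (x + x') y = symmAd g n x y + symmAd g n x' y := by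
  simp only [symmAd, lie_add, map_add, LinearMap.add_apply]; ring

lemma symmAd_smul_left (c : ℝ) (x y : V) : symmAd g n (c • x) y = c * symmAd g n x y := by
  simp only [symmAd, lie_smul, map_smul, LinearMap.smul_apply, smul_eq_mul]; ring

lemma symmAd_add_right (x y y' : V) :
    symmAd g n x (y + y') = symmAd g n x y + symmAd g n x y' := by
  simp only [symmAd, lie_add, map_add]; ring

lemma symmAd_smul_right (c : ℝ) (x y : V) : symmAd g n x (c • y) = c * symmAd g n x y := by
  simp only [symmAd, lie_smul, map_smul, smul_eq_mul]; ring

lemma symmAd_neg_right (x y : V) : symmAd g n x (-y) = -symmAd g n x y := by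
  simp only [symmAd, lie_neg, map_neg]; ring

/-- `J` occurs four times in each term. This allows replacing `K` by `-K` when `K n = -J n`. -/
lemma torsion_neg_complex (x y z : V) : torsion g (-J) x y z = torsion g J x y z := by
  simp only [torsion, dform, LinearMap.neg_apply, map_neg, neg_lie, lie_neg, neg_neg]

end Multilinear

namespace IsHermitianWithNormal

variable {g : V →ₗ[ℝ] V →ₗ[ℝ] ℝ} {J K : V →ₗ[ℝ] V} {n : V}

lemma neg (H : IsHermitianWithNormal g J n) : IsHermitianWithNormal g (-J) n where
  symm := H.symm
  pos := H.pos
  sq x := by simp [H.sq]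
  compat x y := by simp [H.compat]
  integrable x y := by
    simpa only [LinearMap.neg_apply, map_neg, neg_lie, lie_neg, neg_neg] using H.integrable x y
  unit := H.unit
  comm := H.comm
  ideal := H.ideal

section

variable (H : IsHermitianWithNormal g J n)
include H

lemma eq_zero_of_self {x : V} (h : g x x = 0) : x = 0 := by
  by_contra hx
  exact (H.pos x hx).ne' h

lemma skew (x y : V) : g (J x) y = -g x (J y) := by
  rw [← H.compat x (J y), H.sq, map_neg, neg_neg]

lemma self_complex (x : V) : g x (J x) = 0 := by
  have := H.skew x x
  rw [H.symm] at this
  linarith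

lemma complex_self (x : V) : g (J x) x = 0 := by rw [H.symm, H.self_complex]

lemma unit_complex : g (J n) (J n) = 1 := by rw [H.compat, H.unit]

lemma normal_complex {x : V} (hx : g (J n) x = 0) : g n (J x) = 0 := by
  have := H.skew n x
  linarith

lemma complex_normal_complex {x : V} (hx : g n x = 0) : g (J n) (J x) = 0 := by
  rw [H.compat, hx]

/-- In the Nijenhuis tensor at (n, x), the brackets [Jn, Jx] and [Jn, x] lie inside the abelian
ideal and vanish. What remains is the commutation of ad `n` with `J`; as [n, Jx] = J[n, x] is
orthogonal to `n`, [n, x] is orthogonal to `J n`. -/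
lemma complex_normal_lie {x : V} (hx : g n x = 0) (hx' : g (J n) x = 0) :
    g (J n) ⁅n, x⁆ = 0 ∧ ⁅n, J x⁆ = J ⁅n, x⁆ := by
  have h := H.integrable n x
  rw [H.comm _ _ (H.self_complex n) (H.normal_complex hx'), H.comm _ _ (H.self_complex n) hx,
    map_zero] at h
  have h1 : J ⁅n, J x⁆ = -⁅n, x⁆ := by
    rw [sub_zero, zero_sub, sub_eq_zero] at h
    rw [← h, neg_neg]
  have h2 : ⁅n, J x⁆ = J ⁅n, x⁆ := by
    have := congrArg J h1
    rw [H.sq, map_neg] at this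
    exact neg_injective this
  refine ⟨?_, h2⟩
  rw [H.skew, ← h2, H.ideal, neg_zero]

/-- Since W is ad `n`-invariant, only the `J n`-component of x contributes: `J n` is an eigenvector
of the transpose of ad `n` on the ideal. -/
lemma complex_normal_lie_eq {x : V} (hx : g n x = 0) :
    g (J n) ⁅n, x⁆ = g (J n) ⁅n, J n⁆ * g (J n) x := by
  have h1 : g n (x - g (J n) x • J n) = 0 := by simp [hx, H.self_complex]
  have h2 : g (J n) (x - g (J n) x • J n) = 0 := by simp [H.unit_complex]
  have := (H.complex_normal_lie h1 h2).1
  simp only [lie_sub, lie_smul, map_sub, map_smul, smul_eq_mul] at this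
  linarith

lemma dform_normal {x y : V} (hx : g n x = 0) (hy : g n y = 0) :
    dform g J n x y = g ⁅n, x⁆ (J y) - g ⁅n, y⁆ (J x) := by
  rw [dform, H.comm x y hx hy, H.skew, H.skew]; simp; ring

lemma dform_eq_zero_of_normal {x y z : V} (hx : g n x = 0) (hy : g n y = 0) (hz : g n z = 0) :
    dform g J x y z = 0 := by
  simp [dform, H.comm x y hx hy, H.comm x z hx hz, H.comm y z hy hz]

lemma torsion_eq_zero {x y z : V} (hx : g (J n) x = 0) (hy : g (J n) y = 0) (hz : g (J n) z = 0) :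
    torsion g J x y z = 0 := by
  rw [torsion, H.dform_eq_zero_of_normal (H.normal_complex hx) (H.normal_complex hy)
    (H.normal_complex hz), neg_zero]

/-- The left side is dω(n, Jy, Jz), and [n, Jy] = J[n, y]. Only z ⟂ `J n` is needed, so z may have
an `n`-component. -/
lemma torsion_complex_normal {y z : V} (hy : g n y = 0) (hy' : g (J n) y = 0)
    (hz' : g (J n) z = 0) :
    torsion g J (J n) y z = symmAd g n y (J z) := by
  have h : (-n : V) = (-1 : ℝ) • n := by simp
  rw [torsion, H.sq, h, dform_smul, H.dform_normal (H.normal_complex hy') (H.normal_complex hz'),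
    H.sq, H.sq, (H.complex_normal_lie hy hy').2, symmAd, H.skew, H.symm y, map_neg, map_neg,
    map_neg]
  ring

lemma torsion_complex_normal_normal {y : V} (hy : g n y = 0) (hy' : g (J n) y = 0) :
    torsion g J (J n) y n = g ⁅n, J n⁆ y := by
  have h : (-n : V) = (-1 : ℝ) • n := by simp
  rw [torsion, H.sq, h, dform_smul, H.dform_normal (H.normal_complex hy') (H.self_complex n),
    H.sq, H.sq, (H.complex_normal_lie hy hy').2, map_neg, map_neg, H.symm (J _) n,
    H.normal_complex (H.complex_normal_lie hy hy').1]
  ring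

lemma symmAd_complex {x y : V} (hx : g n x = 0) (hx' : g (J n) x = 0)
    (hy : g n y = 0) (hy' : g (J n) y = 0) :
    symmAd g n (J x) (J y) = symmAd g n x y := by
  rw [symmAd, (H.complex_normal_lie hx hx').2, (H.complex_normal_lie hy hy').2, H.compat, H.compat,
    symmAd]

lemma symmAd_symm (x y : V) : symmAd g n x y = symmAd g n y x := by
  rw [symmAd, symmAd, H.symm, H.symm x]; ring

/-- The Kähler criterion. As dω vanishes on the abelian ideal, only dω(n, ·, ·) matters; `hs`
handles two arguments in W, `hv` the pair (`J n`, W). -/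
lemma dform_eq_zero
    (hs : ∀ x y, g n x = 0 → g (J n) x = 0 → g n y = 0 → g (J n) y = 0 → symmAd g n x y = 0)
    (hv : ∀ y, g n y = 0 → g (J n) y = 0 → g ⁅n, J n⁆ y = 0) (x y z : V) :
    dform g J x y z = 0 := by
  have h1 : ∀ x y, g n x = 0 → g (J n) x = 0 → g n y = 0 → g (J n) y = 0 →
      dform g J n x y = 0 := by
    intro x y hx hx' hy hy'
    have := hs x (J y) hx hx' (H.normal_complex hy') (H.complex_normal_complex hy)
    rw [symmAd, (H.complex_normal_lie hy hy').2, H.symm x, H.skew] at this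
    rw [H.dform_normal hx hy]
    linarith
  have h2 : ∀ y, g n y = 0 → g (J n) y = 0 → dform g J n (J n) y = 0 := by
    intro y hy hy'
    rw [H.dform_normal (H.self_complex n) hy, hv _ (H.normal_complex hy')
      (H.complex_normal_complex hy), H.sq, map_neg, H.symm _ n, H.ideal]
    simp
  have h3 : dform g J n (J n) (J n) = 0 := by
    have := dform_swap_right g J n (J n) (J n)
    linarith
  have h4 : ∀ x y, g n x = 0 → g n y = 0 → dform g J n x y = 0 := by
    have hd : ∀ x, g n x = 0 → ∃ (c : ℝ) (x' : V), x = c • J n + x' ∧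
        g n x' = 0 ∧ g (J n) x' = 0 := by
      intro x hx
      refine ⟨g (J n) x, x - g (J n) x • J n, by simp, ?_, ?_⟩
      · simp [hx, H.self_complex]
      · simp [H.unit_complex]
    intro x y hx hy
    obtain ⟨c, x', rfl, hx1, hx2⟩ := hd x hx
    obtain ⟨d, y', rfl, hy1, hy2⟩ := hd y hy
    have := dform_swap_right g J n (J n) x'
    rw [h2 x' hx1 hx2] at this
    simp only [dform_add_mid, dform_add_right, dform_smul_mid, dform_smul_right, h3, h2 y' hy1 hy2,
      h1 x' y' hx1 hx2 hy1 hy2, this]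
    ring
  have h5 : ∀ x, dform g J n n x = 0 ∧ dform g J n x n = 0 ∧ dform g J x n n = 0 := by
    intro x
    have e1 := dform_swap_left g J n n x
    have e2 := dform_swap_right g J n n x
    have e3 := dform_swap_left g J n x n
    refine ⟨by linarith, by linarith, by linarith⟩
  have hd : ∀ x, ∃ (c : ℝ) (x' : V), x = c • n + x' ∧ g n x' = 0 := by
    intro x
    exact ⟨g n x, x - g n x • n, by simp, by simp [H.unit]⟩
  obtain ⟨a, x, rfl, hx⟩ := hd x
  obtain ⟨b, y, rfl, hy⟩ := hd y
  obtain ⟨c, z, rfl, hz⟩ := hd z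
  simp only [dform_add, dform_smul, dform_add_mid, dform_add_right, dform_smul_mid,
    dform_smul_right, h5, h4 _ _ hx hy, h4 _ _ hx hz, h4 _ _ hy hz,
    H.dform_eq_zero_of_normal hx hy hz, dform_swap_left g J n x z, dform_swap_right g J x n y,
    dform_swap_left g J n x y]
  ring

end

end IsHermitianWithNormal

end AlmostAbelian

/-! ### The SKT condition, and pairs with opposite torsion. -/

namespace AlmostAbelian

variable {V : Type*} [LieRing V] [LieAlgebra ℝ V]
variable {g : V →ₗ[ℝ] V →ₗ[ℝ] ℝ} {J K : V →ₗ[ℝ] V} {n : V}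

namespace IsHermitianWithNormal

/-- This is the component (n, Jn, y, z) of dd^cω = 0, where only brackets with `n` survive. -/
lemma symmAd_of_dTorsion_eq_zero (H : IsHermitianWithNormal g J n)
    (hd : ∀ x y z w, dTorsion g J x y z w = 0) {y z : V} (hy : g n y = 0) (hy' : g (J n) y = 0)
    (hz : g n z = 0) (hz' : g (J n) z = 0) :
    g (J n) ⁅n, J n⁆ * symmAd g n y (J z) + symmAd g n ⁅n, y⁆ (J z) + symmAd g n y (J ⁅n, z⁆)
      = 0 := by
  have h0 : ∀ a b, torsion g J 0 a b = 0 := fun a b => by simp [torsion, dform]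
  have h := hd n (J n) y z
  have hy2 := (H.complex_normal_lie hy hy').1
  have hz2 := (H.complex_normal_lie hz hz').1
  -- Only the `J n`-component of [n, Jn] counts, as the torsion vanishes on (`J n`)^⊥.
  have hv : torsion g J ⁅n, J n⁆ y z = g (J n) ⁅n, J n⁆ * symmAd g n y (J z) := by
    have e : ⁅n, J n⁆ = g (J n) ⁅n, J n⁆ • J n + (⁅n, J n⁆ - g (J n) ⁅n, J n⁆ • J n) := by simp
    rw [e, torsion_add, torsion_smul, H.torsion_complex_normal hy hy' hz',
      H.torsion_eq_zero (by simp [H.unit_complex]) hy' hz', ← e, add_zero]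
  rw [dTorsion, H.comm _ _ (H.self_complex n) hy, H.comm _ _ (H.self_complex n) hz,
    H.comm _ _ hy hz, h0, h0, h0, hv, torsion_swap_left g J (J n), torsion_swap_left g J (J n),
    torsion_swap_right g J _ y, H.torsion_complex_normal (H.ideal n y) hy2 hz',
    H.torsion_complex_normal hy hy' hz2] at h
  linarith

section

variable (HJ : IsHermitianWithNormal g J n) (HK : IsHermitianWithNormal g K n)
  (ht : ∀ x y z, torsion g J x y z + torsion g K x y z = 0)
include HJ HK ht

/-- Modulo (`K n`)^⊥, where the torsion of `K` vanishes, `J n` equals α `K n`; insert this in the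
torsion identity at (Jn, y, z). -/
lemma symmAd_eq_neg_mul {y z : V} (hy : g n y = 0) (hyJ : g (J n) y = 0) (hyK : g (K n) y = 0)
    (hzJ : g (J n) z = 0) (hzK : g (K n) z = 0) :
    symmAd g n y (J z) = -(g (J n) (K n) * symmAd g n y (K z)) := by
  have h := ht (J n) y z
  have e : J n = g (J n) (K n) • K n + (J n - g (J n) (K n) • K n) := by simp
  rw [HJ.torsion_complex_normal hy hyJ hzJ, e, torsion_add, torsion_smul,
    HK.torsion_complex_normal hy hyK hzK,
    HK.torsion_eq_zero (by simp [HK.unit_complex, HK.symm (K n)]) hyK hzK] at h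
  linarith

lemma normal_lie_eq_neg_mul {y : V} (hy : g n y = 0) (hyJ : g (J n) y = 0) (hyK : g (K n) y = 0) :
    g ⁅n, J n⁆ y = -(g (J n) (K n) * g ⁅n, K n⁆ y) := by
  have h := ht (J n) y n
  have e : J n = g (J n) (K n) • K n + (J n - g (J n) (K n) • K n) := by simp
  rw [HJ.torsion_complex_normal_normal hy hyJ, e, torsion_add, torsion_smul,
    HK.torsion_complex_normal_normal hy hyK,
    HK.torsion_eq_zero (by simp [HK.unit_complex, HK.symm (K n)]) hyK (HK.complex_self n), ← e] at h
  linarith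

variable (hα : g (J n) (K n) ^ 2 < 1)
include hα

/-- The preceding relation and its mirror image combine to (1 - α²) S(y, Jz) = 0. -/
lemma symmAd_eq_zero_of_orthogonal {y z : V} (hy : g n y = 0) (hyJ : g (J n) y = 0)
    (hyK : g (K n) y = 0) (hzJ : g (J n) z = 0) (hzK : g (K n) z = 0) :
    symmAd g n y (J z) = 0 := by
  have h1 := symmAd_eq_neg_mul HJ HK ht hy hyJ hyK hzJ hzK
  have h2 := symmAd_eq_neg_mul HK HJ (fun x y z => by rw [add_comm, ht]) hy hyK hyJ hzK hzJ
  rw [HJ.symm (K n)] at h2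
  have h3 : (1 - g (J n) (K n) ^ 2) * symmAd g n y (J z) = 0 := by
    linear_combination h1 - g (J n) (K n) * h2
  exact (mul_eq_zero.1 h3).resolve_left (by linarith)

/-- Take z = Ju above: it is orthogonal to `J n` and to u, hence to `K n`. -/
lemma symmAd_difference_eq_zero {y : V} (hy : g n y = 0) (hyJ : g (J n) y = 0)
    (hyu : g (K n - g (J n) (K n) • J n) y = 0) :
    symmAd g n y (K n - g (J n) (K n) • J n) = 0 := by
  set u := K n - g (J n) (K n) • J n with hu
  have hKn : K n = u + g (J n) (K n) • J n := by simp [hu]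
  have hu1 : g n u = 0 := by simp [hu, HJ.self_complex, HK.self_complex]
  have hu2 : g (J n) u = 0 := by simp [hu, HJ.unit_complex]
  have h := symmAd_eq_zero_of_orthogonal HJ HK ht hα hy hyJ
    (by rw [hKn, map_add, map_smul, LinearMap.add_apply, LinearMap.smul_apply, hyu, hyJ]; simp)
    (HJ.complex_normal_complex hu1)
    (by rw [hKn, map_add, map_smul, LinearMap.add_apply, LinearMap.smul_apply, HJ.self_complex,
          HJ.complex_normal_complex hu1]; simp)
  rw [HJ.sq, symmAd_neg_right] at h
  linarith

lemma symmAd_difference_self (hJ : ∀ x y z w, dTorsion g J x y z w = 0) :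
    (g (J n) ⁅n, J n⁆ + 2 * g (K n) ⁅n, K n⁆) * g (K n) ⁅n, K n⁆ = 0 ∧
      symmAd g n (K n - g (J n) (K n) • J n) (K n - g (J n) (K n) • J n) =
        2 * g (K n) ⁅n, K n⁆ * (1 - g (J n) (K n) ^ 2) := by
  set u := K n - g (J n) (K n) • J n with hu
  have hu1 : g n u = 0 := by simp [hu, HJ.self_complex, HK.self_complex]
  have hu2 : g (J n) u = 0 := by simp [hu, HJ.unit_complex]
  have huu : g u u = 1 - g (J n) (K n) ^ 2 := by
    conv_lhs => rw [hu]
    simp only [map_sub, map_smul, LinearMap.sub_apply, LinearMap.smul_apply, smul_eq_mul,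
      HJ.unit_complex, HK.unit_complex, HJ.symm (K n) (J n)]
    ring
  -- Pair [n, u] with `K n` using integrability of `K`, and with `J n` using that of `J`.
  have hBu : g u ⁅n, u⁆ = g (K n) ⁅n, K n⁆ * g u u := by
    have h1 : g (K n) ⁅n, u⁆ = g (K n) ⁅n, K n⁆ * g (K n) u := HK.complex_normal_lie_eq hu1
    have h2 := (HJ.complex_normal_lie hu1 hu2).1
    have h3 : ∀ x, g u x = g (K n) x - g (J n) (K n) * g (J n) x := by simp [hu]
    rw [h3, h3, h1, h2, hu2]
    ring
  have hs : symmAd g n u u = 2 * g (K n) ⁅n, K n⁆ * (1 - g (J n) (K n) ^ 2) := by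
    rw [symmAd, HJ.symm _ u, hBu, huu]; ring
  refine ⟨?_, hs⟩
  have hm2 := (HJ.complex_normal_lie hu1 hu2).1
  have hr : symmAd g n ⁅n, u⁆ u = g (K n) ⁅n, K n⁆ * symmAd g n u u := by
    -- By `hBu` this y is the part of [n, u] orthogonal to u.
    have h := symmAd_difference_eq_zero HJ HK ht hα (y := ⁅n, u⁆ - g (K n) ⁅n, K n⁆ • u)
      (by simp [HJ.ideal, hu1]) (by simp [hm2, hu2]) (by simp [← hu, hBu])
    rw [← hu, sub_eq_add_neg, ← neg_smul, symmAd_add_left, symmAd_smul_left] at h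
    linarith
  -- With z = -Ju one has Jz = u, and the SKT identity reads a_J S(u, u) + 2 S([n, u], u) = 0.
  have h := HJ.symmAd_of_dTorsion_eq_zero hJ hu1 hu2 (z := -J u)
    (by simp [HJ.normal_complex hu2]) (by simp [HJ.complex_normal_complex hu1])
  rw [map_neg, HJ.sq, neg_neg, lie_neg, (HJ.complex_normal_lie hu1 hu2).2, map_neg, HJ.sq, neg_neg,
    HJ.symmAd_symm u ⁅n, u⁆, hr, hs] at h
  have h4 : (1 - g (J n) (K n) ^ 2) ≠ 0 := by linarith
  apply mul_right_cancel₀ h4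
  linear_combination h / 2

lemma normal_lie_normal_eq_zero (hJ : ∀ x y z w, dTorsion g J x y z w = 0)
    (hK : ∀ x y z w, dTorsion g K x y z w = 0) :
    g (K n) ⁅n, K n⁆ = 0 := by
  have h1 := (symmAd_difference_self HJ HK ht hα hJ).1
  have h2 := (symmAd_difference_self HK HJ (fun x y z => by rw [add_comm, ht])
    (by rwa [HJ.symm]) hK).1
  rcases mul_eq_zero.1 h1 with h | h
  · rw [eq_neg_of_add_eq_zero_left h] at h2
    -- Substituting a_J = -2a_K into (a_K + 2a_J) a_J gives 6 a_K².
    have : g (K n) ⁅n, K n⁆ ^ 2 = 0 := by linear_combination h2 / 6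
    exact pow_eq_zero_iff two_ne_zero |>.1 this
  · exact h

theorem dform_eq_zero_of_sq_lt_one (hJ : ∀ x y z w, dTorsion g J x y z w = 0)
    (hK : ∀ x y z w, dTorsion g K x y z w = 0) (x y z : V) :
    dform g J x y z = 0 := by
  have haK := normal_lie_normal_eq_zero HJ HK ht hα hJ hK
  have haJ := normal_lie_normal_eq_zero HK HJ (fun x y z => by rw [add_comm, ht])
    (by rwa [HJ.symm]) hK hJ
  have hsu := (symmAd_difference_self HJ HK ht hα hJ).2
  rw [haK, mul_zero, zero_mul] at hsu
  have hsy := fun y => symmAd_difference_eq_zero HJ HK ht hα (y := y)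
  set u := K n - g (J n) (K n) • J n with hu
  have hKn : K n = u + g (J n) (K n) • J n := by simp [hu]
  have hKx : ∀ x, g (K n) x = g u x + g (J n) (K n) * g (J n) x := by simp [hu]
  have hu1 : g n u = 0 := by simp [hu, HJ.self_complex, HK.self_complex]
  have hu2 : g (J n) u = 0 := by simp [hu, HJ.unit_complex]
  have huu : g u u = 1 - g (J n) (K n) ^ 2 := by
    conv_lhs => rw [hu]
    simp only [map_sub, map_smul, LinearMap.sub_apply, LinearMap.smul_apply, smul_eq_mul,
      HJ.unit_complex, HK.unit_complex, HJ.symm (K n) (J n)]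
    ring
  have huu0 : g u u ≠ 0 := by rw [huu]; linarith
  have hdu : ∀ y, g n y = 0 → g (J n) y = 0 → ∃ (c : ℝ) (y' : V), y = c • u + y' ∧ g n y' = 0 ∧
      g (J n) y' = 0 ∧ g u y' = 0 := by
    intro y hy hy'
    refine ⟨g u y / g u u, y - (g u y / g u u) • u, by simp, by simp [hy, hu1],
      by simp [hy', hu2], by simp [div_mul_cancel₀ _ huu0]⟩
  have hs1 : ∀ y, g n y = 0 → g (J n) y = 0 → symmAd g n y u = 0 := by
    intro y hy hy'
    obtain ⟨c, y', rfl, h1, h2, h3⟩ := hdu y hy hy'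
    rw [symmAd_add_left, symmAd_smul_left, hsu, hsy y' h1 h2 h3]; simp
  have hs2 : ∀ y, g n y = 0 → g (J n) y = 0 → symmAd g n y (J u) = 0 := by
    intro y hy hy'
    have h := hs1 (J y) (HJ.normal_complex hy') (HJ.complex_normal_complex hy)
    rw [← HJ.symmAd_complex (HJ.normal_complex hy') (HJ.complex_normal_complex hy) hu1 hu2,
      HJ.sq, HJ.symmAd_symm, symmAd_neg_right, HJ.symmAd_symm] at h
    linarith
  refine HJ.dform_eq_zero ?_ ?_ x y z
  · have hd : ∀ y, g n y = 0 → g (J n) y = 0 → ∃ (c d : ℝ) (y' : V), y = c • u + d • J u + y' ∧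
        g n y' = 0 ∧ g (J n) y' = 0 ∧ g u y' = 0 ∧ g (J u) y' = 0 := by
      intro y hy hy'
      have h1 : g n (J u) = 0 := HJ.normal_complex hu2
      have h2 : g (J n) (J u) = 0 := HJ.complex_normal_complex hu1
      have h3 : g (J u) (J u) = g u u := HJ.compat _ _
      refine ⟨g u y / g u u, g (J u) y / g u u,
        y - (g u y / g u u) • u - (g (J u) y / g u u) • J u, by abel, by simp [hy, hu1, h1],
        by simp [hy', hu2, h2], by simp [div_mul_cancel₀ _ huu0, HJ.self_complex],
        by simp [div_mul_cancel₀ _ huu0, HJ.complex_self, h3]⟩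
    have key : ∀ x y, g n x = 0 → g (J n) x = 0 → g u x = 0 → g n y = 0 → g (J n) y = 0 →
        symmAd g n x y = 0 := by
      intro x y hx hx' hxu hy hy'
      obtain ⟨c, d, y', rfl, h1, h2, h3, h4⟩ := hd y hy hy'
      -- Orthogonality of y' to `J u` is what makes z = Jy' orthogonal to `K n`.
      have h5 := symmAd_eq_zero_of_orthogonal HJ HK ht hα hx hx' (by rw [hKx, hxu, hx']; simp)
        (z := J y') (HJ.complex_normal_complex h1)
        (by rw [hKx, HJ.complex_normal_complex h1]; have := HJ.skew u y'; linarith)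
      rw [HJ.sq, symmAd_neg_right] at h5
      rw [symmAd_add_right, symmAd_add_right, symmAd_smul_right, symmAd_smul_right, hs1 x hx hx',
        hs2 x hx hx']
      linarith
    intro x y hx hx' hy hy'
    obtain ⟨c, x', rfl, h1, h2, h3⟩ := hdu x hx hx'
    rw [symmAd_add_left, symmAd_smul_left, key x' y h1 h2 h3 hy hy', HJ.symmAd_symm, hs1 y hy hy']
    simp
  · intro y hy hy'
    obtain ⟨c, y', rfl, h1, h2, h3⟩ := hdu y hy hy'
    have h4 : g (K n) y' = 0 := by rw [hKx, h3, h2]; simp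
    have e1 := normal_lie_eq_neg_mul HJ HK ht h1 h2 h4
    have e2 := normal_lie_eq_neg_mul HK HJ (fun x y z => by rw [add_comm, ht]) h1 h4 h2
    rw [HJ.symm (K n)] at e2
    have e3 : (1 - g (J n) (K n) ^ 2) * g ⁅n, J n⁆ y' = 0 := by
      linear_combination e1 - g (J n) (K n) * e2
    have e4 : g ⁅n, J n⁆ y' = 0 := (mul_eq_zero.1 e3).resolve_left (by linarith)
    -- This settles the u-component of [n, Jn]: with a_J = a_K = 0 it reduces to g(u, [n, Jn]) = 0.
    have e5 : g (K n) ⁅n, J n⁆ = g (K n) ⁅n, K n⁆ * g (K n) (J n) :=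
      HK.complex_normal_lie_eq (HJ.self_complex n)
    rw [hKx, haJ, haK] at e5
    rw [map_add, map_smul, e4, HJ.symm _ u]
    simp only [smul_eq_mul]
    linear_combination c * e5

end

/-! ### The case of proportional `J n` and `K n`, in dimension six. -/

section

variable (HJ : IsHermitianWithNormal g J n) (HK : IsHermitianWithNormal g K n)
include HJ HK

/-- Two anticommuting vectors besides a common `J`-line force the commutator to vanish in
dimension six. -/
lemma comm_of_exists (hdim : Module.finrank ℝ V = 6) (hn : K n = J n) {w : V} (hw : w ≠ 0)
    (hw1 : g n w = 0) (hw2 : g (J n) w = 0) (hw3 : K w = -J w) (x : V) :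
    J (K x) = K (J x) := by
  set C : V →ₗ[ℝ] V := J ∘ₗ K - K ∘ₗ J with hC
  have hCx : ∀ x, C x = J (K x) - K (J x) := fun x => rfl
  suffices C x = 0 by rwa [hCx, sub_eq_zero] at this
  have hskew : ∀ x y, g (C x) y = -g x (C y) := by
    intro x y
    simp only [hCx, map_sub, LinearMap.sub_apply, HJ.skew, HK.skew]; ring
  have hCJ : ∀ x, C (J x) = -J (C x) := by
    intro x
    simp only [hCx, map_sub, HJ.sq, map_neg]; abel
  have hself : ∀ x, g x (C x) = 0 := by
    intro x
    have := hskew x x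
    rw [HJ.symm] at this
    linarith
  have hJself : ∀ x, g (J x) (C x) = 0 := by
    intro x
    rw [hCx, map_sub, HJ.compat, HK.self_complex, HJ.symm, HK.complex_self, sub_zero]
  have hCn : C n = 0 := by
    rw [hCx, hn, HJ.sq, ← hn, HK.sq, sub_self]
  have hCw : C w = 0 := by
    have := HK.sq w
    rw [hw3, map_neg] at this
    rw [hCx, hw3, map_neg, HJ.sq, neg_neg, neg_injective this, sub_self]
  have hCJn : C (J n) = 0 := by rw [hCJ, hCn, map_zero, neg_zero]
  have hCJw : C (J w) = 0 := by rw [hCJ, hCw, map_zero, neg_zero]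
  -- C is skew, so its image is orthogonal to its kernel.
  have hker : ∀ y z, C y = 0 → g y (C z) = 0 := by
    intro y z hy
    have := hskew y z
    rw [hy, map_zero, LinearMap.zero_apply] at this
    linarith
  by_contra hp
  set p := C x with hpdef
  have hq : C p ≠ 0 := by
    intro h
    have := hskew x p
    rw [h, ← hpdef, map_zero, neg_zero] at this
    exact hp (HJ.eq_zero_of_self this)
  have hJ0 : ∀ y, y ≠ 0 → J y ≠ 0 := by
    intro y hy h
    have := HJ.sq y
    rw [h, map_zero] at this
    exact hy (neg_eq_zero.1 this.symm)
  have hn0 : n ≠ 0 := by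
    rintro rfl
    have := HJ.unit
    simp at this
  have hJp : J p = C (-J x) := by rw [map_neg, hCJ, neg_neg]
  -- Four orthogonal vectors in ker C and three in the image of C: if p ≠ 0, these are seven nonzero
  -- orthogonal vectors in a six-dimensional space.
  let v : Fin 7 → V := ![n, J n, w, J w, p, J p, C p]
  have hv0 : ∀ i, v i ≠ 0 := by
    intro i
    fin_cases i
    exacts [hn0, hJ0 n hn0, hw, hJ0 w hw, hp, hJ0 p hp, hq]
  have hort : ∀ i j, i < j → g (v i) (v j) = 0 := by
    have h1 : ∀ y, C y = 0 → g y p = 0 ∧ g y (J p) = 0 ∧ g y (C p) = 0 := fun y hy =>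
      ⟨hker y _ hy, by rw [hJp]; exact hker y _ hy, hker y _ hy⟩
    obtain ⟨a1, a2, a3⟩ := h1 n hCn
    obtain ⟨b1, b2, b3⟩ := h1 _ hCJn
    obtain ⟨c1, c2, c3⟩ := h1 w hCw
    obtain ⟨d1, d2, d3⟩ := h1 _ hCJw
    have e1 := HJ.normal_complex hw2
    have e2 := HJ.complex_normal_complex hw1
    have e3 := HJ.self_complex n
    have e4 := HJ.self_complex w
    have e5 := HJ.self_complex p
    have e6 := hself p
    have e7 := hJself p
    intro i j hij
    fin_cases i <;> fin_cases j <;> first | (exfalso; revert hij; decide) | assumption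
  have hli : LinearIndependent ℝ v := by
    refine LinearMap.BilinForm.linearIndependent_of_iIsOrtho (B := g) ?_ ?_
    · intro i j hij
      rcases lt_or_gt_of_ne hij with h | h
      · exact hort i j h
      · exact (HJ.symm _ _).trans (hort j i h)
    · intro i h
      exact (HJ.pos _ (hv0 i)).ne' h
  have : FiniteDimensional ℝ V := Module.finite_of_finrank_pos (by omega)
  have := hli.fintype_card_le_finrank
  simp [hdim] at this

/-- The dichotomy is whether J + K has a kernel on W. If not, it is onto W and S(y, (J + K)z) = 0
kills S there, while the torsion identity at (Jn, y, n) reads 2 g([n, Jn], y) = 0. -/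
lemma dform_eq_zero_or_comm_of_eq (hdim : Module.finrank ℝ V = 6)
    (ht : ∀ x y z, torsion g J x y z + torsion g K x y z = 0) (hn : K n = J n) :
    (∀ x y z, dform g J x y z = 0) ∨ ∀ x, J (K x) = K (J x) := by
  have hfin : FiniteDimensional ℝ V := Module.finite_of_finrank_pos (by omega)
  by_cases hw : ∃ w, w ≠ 0 ∧ g n w = 0 ∧ g (J n) w = 0 ∧ K w = -J w
  · obtain ⟨w, h1, h2, h3, h4⟩ := hw
    exact Or.inr (comm_of_exists HJ HK hdim hn h1 h2 h3 h4)
  left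
  have hs : ∀ y z, g n y = 0 → g (J n) y = 0 → g n z = 0 → g (J n) z = 0 →
      symmAd g n y ((J + K) z) = 0 := by
    intro y z hy hy' hz hz'
    have h := ht (J n) y z
    rw [HJ.torsion_complex_normal hy hy' hz', ← hn,
      HK.torsion_complex_normal hy (by rwa [hn]) (by rwa [hn])] at h
    rw [LinearMap.add_apply, symmAd_add_right, h]
  let W : Submodule ℝ V := LinearMap.ker (g n) ⊓ LinearMap.ker (g (J n))
  have hW : ∀ x, x ∈ W ↔ g n x = 0 ∧ g (J n) x = 0 := fun x => by simp [W]
  have hmap : ∀ x ∈ W, (J + K) x ∈ W := by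
    intro x hx
    rw [hW] at hx ⊢
    have h := HK.normal_complex (x := x) (by rw [hn]; exact hx.2)
    have h' := HK.complex_normal_complex (x := x) hx.1
    rw [hn] at h'
    simp [h, h', HJ.normal_complex hx.2, HJ.complex_normal_complex hx.1]
  have hinj : Function.Injective ((J + K).restrict hmap) := by
    rw [injective_iff_map_eq_zero]
    rintro ⟨w, hw'⟩ h
    by_contra h0
    refine hw ⟨w, fun e => h0 (by simpa using e), ((hW w).1 hw').1, ((hW w).1 hw').2, ?_⟩
    have : J w + K w = 0 := congrArg Subtype.val h
    exact eq_neg_of_add_eq_zero_right this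
  have hsurj := LinearMap.injective_iff_surjective.1 hinj
  refine HJ.dform_eq_zero ?_ ?_
  · intro x y hx hx' hy hy'
    obtain ⟨⟨z, hz⟩, h⟩ := hsurj ⟨y, (hW y).2 ⟨hy, hy'⟩⟩
    have h' : (J + K) z = y := congrArg Subtype.val h
    rw [← h']
    exact hs x z hx hx' ((hW z).1 hz).1 ((hW z).1 hz).2
  · intro y hy hy'
    have h := ht (J n) y n
    have h' := HK.torsion_complex_normal_normal hy (by rwa [hn])
    rw [hn] at h'
    rw [HJ.torsion_complex_normal_normal hy hy', h'] at h
    linarith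

/-- On a six-dimensional almost abelian Lie algebra, a generalized Kähler structure `(J, K, g)`
is split unless `(J, g)` is Kähler. -/
theorem dform_eq_zero_or_comm (hdim : Module.finrank ℝ V = 6)
    (ht : ∀ x y z, torsion g J x y z + torsion g K x y z = 0)
    (hJ : ∀ x y z w, dTorsion g J x y z w = 0) (hK : ∀ x y z w, dTorsion g K x y z w = 0) :
    (∀ x y z, dform g J x y z = 0) ∨ ∀ x, J (K x) = K (J x) := by
  by_cases hα : g (J n) (K n) ^ 2 < 1
  · exact Or.inl (dform_eq_zero_of_sq_lt_one HJ HK ht hα hJ hK)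
  -- The squared length of u is 1 - α², so α² ≥ 1 forces u = 0 and α = ±1.
  have huu : g (K n - g (J n) (K n) • J n) (K n - g (J n) (K n) • J n)
      = 1 - g (J n) (K n) ^ 2 := by
    simp only [map_sub, map_smul, LinearMap.sub_apply, LinearMap.smul_apply, smul_eq_mul,
      HJ.unit_complex, HK.unit_complex, HJ.symm (K n) (J n)]
    ring
  have hu : K n = g (J n) (K n) • J n := by
    by_contra hne
    have := HJ.pos _ (sub_ne_zero.2 hne)
    linarith
  have h1 : g (J n) (K n) ^ 2 = 1 := by
    rw [← hu, sub_self, map_zero] at huu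
    linarith
  rcases mul_self_eq_one_iff.1 ((pow_two _).symm.trans h1) with h | h
  · exact dform_eq_zero_or_comm_of_eq HJ HK hdim ht (by rw [hu, h, one_smul])
  · have := dform_eq_zero_or_comm_of_eq HJ HK.neg hdim
      (fun x y z => by rw [torsion_neg_complex, ht])
      (by rw [LinearMap.neg_apply, hu, h]; simp)
    simpa using this

end

end IsHermitianWithNormal

end AlmostAbelian

/-! ### Left-invariant fields and left trivialization on a Lie group. -/

open scoped Manifold ContDiff

noncomputable section

namespace LieGeom

open VectorField Bundle

variable {E : Type*} [NormedAddCommGroup E] [NormedSpace ℝ E]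
  {H : Type*} [TopologicalSpace H] {I : ModelWithCorners ℝ E H}
  {G : Type*} [TopologicalSpace G] [ChartedSpace H G] [Group G] [LieGroup I ∞ G]

lemma contMDiff_tangentMap_mul : ContMDiff (I.tangent.prod I.tangent) I.tangent ∞
    (fun z : TangentBundle I G × TangentBundle I G =>
      tangentMap (I.prod I) I (fun p : G × G => p.1 * p.2)
        ((equivTangentBundleProd I G I G).symm z)) :=
  (ContMDiff.contMDiff_tangentMap (contMDiff_mul I ∞) (m := ∞) le_rfl).comp
    contMDiff_equivTangentBundleProd_symm

lemma tangentMap_mul_zero_left (a x : G) (w : TangentSpace I x) :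
    tangentMap (I.prod I) I (fun p : G × G => p.1 * p.2)
        ((equivTangentBundleProd I G I G).symm (⟨a, 0⟩, ⟨x, w⟩)) =
      ⟨a * x, mfderiv I I (fun y : G => a * y) x w⟩ := by
  have h := mfderiv_prod_eq_add_apply (I := I) (I' := I) (I'' := I)
    (f := fun p : G × G => p.1 * p.2) (p := (a, x)) (v := ((0 : E), (w : E)))
    ((contMDiff_mul I ∞).mdifferentiableAt (by simp))
  have h0 : mfderiv I I (fun z : G => z * x) a (0 : TangentSpace I a) = 0 := map_zero _
  have h' := h.trans ((congrArg (· + mfderiv I I (fun y : G => a * y) x w) h0).trans (zero_add _))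
  exact congrArg (fun u : TangentSpace I (a * x) => (⟨a * x, u⟩ : TangentBundle I G)) h'

/-- Left-invariant vector fields on a smooth Lie group are smooth. -/
lemma isSmooth_mulInvariantVectorField (v : GroupLieAlgebra I G) :
    IsSmooth (mulInvariantVectorField v : VField I G) := by
  have s₁ : ContMDiff I I.tangent ∞ (fun g : G => (⟨g, 0⟩ : TangentBundle I G)) :=
    contMDiff_zeroSection _ _
  have s₂ : ContMDiff I I.tangent ∞ (fun _ : G => (⟨1, v⟩ : TangentBundle I G)) := contMDiff_const
  have S := contMDiff_tangentMap_mul.comp (s₁.prodMk s₂)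
  have : ∀ a : G, (⟨a * 1, mfderiv I I (fun y : G => a * y) 1 v⟩ : TangentBundle I G) =
      ⟨a, mfderiv I I (fun y : G => a * y) 1 v⟩ := by
    intro a
    congr 1
    exact mul_one a
  refine S.congr fun a => ?_
  exact ((tangentMap_mul_zero_left a 1 v).trans (this a)).symm

lemma trivializationAt_snd_of_proj_eq (b : G) (z : TangentBundle I G) (hz : z.proj = b) :
    (trivializationAt E (TangentSpace I) b z).2 = z.2 := by
  subst hz
  exact (tangentBundleCore I G).coordChange_self (achart H z.proj) z.proj
    (mem_chart_source H z.proj) z.2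

/-- The left trivialization of a vector field on a Lie group. -/
def leftTriv (X : VField I G) (x : G) : E := mfderiv I I (fun y : G => x⁻¹ * y) x (X x)

/-- The tangent map of multiplication sends (0 at x⁻¹, X x) to `leftTriv X x`. It always lands over
x⁻¹x = 1, where the trivialization at 1 is the identity. -/
lemma mdifferentiableAt_leftTriv {X : VField I G} {p : G}
    (hX : MDifferentiableAt I I.tangent (fun x => (⟨x, X x⟩ : TangentBundle I G)) p) :
    MDifferentiableAt I 𝓘(ℝ, E) (leftTriv X) p := by
  have s₁ : ContMDiff I I.tangent ∞ (fun g : G => (⟨g, 0⟩ : TangentBundle I G)) :=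
    contMDiff_zeroSection _ _
  have s₂ : MDifferentiableAt I I.tangent (fun x : G => (⟨x⁻¹, 0⟩ : TangentBundle I G)) p :=
    (s₁.comp (contMDiff_inv I ∞)).mdifferentiableAt (by simp)
  have S := (contMDiff_tangentMap_mul.mdifferentiableAt (by simp)).comp p (s₂.prodMk hX)
  rw [mdifferentiableAt_totalSpace] at S
  refine S.2.congr_of_eventuallyEq (Filter.Eventually.of_forall fun x => ?_)
  simp only [Function.comp_apply, tangentMap_mul_zero_left]
  rw [trivializationAt_snd_of_proj_eq]
  · rfl
  · simp

/-- The value of a field of bilinear forms at the identity. -/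
def BilinField.atOne (β : BilinField I G) : E →ₗ[ℝ] E →ₗ[ℝ] ℝ := β 1

omit [LieGroup I ∞ G] in
lemma BilinField.LeftInvariant.apply_eq {β : BilinField I G} (hβ : β.LeftInvariant)
    (X Y : VField I G) (x : G) :
    β x (X x) (Y x) = β.atOne (leftTriv X x) (leftTriv Y x) := by
  rw [← hβ x⁻¹ x (X x) (Y x)]
  -- The base point x⁻¹x equals 1 only propositionally; all tangent spaces are the same type `E`, so
  -- the equality can be substituted.
  have : ∀ (a : G) (_ : a = 1) (v w : TangentSpace I a), β a v w = β.atOne v w := by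
    rintro a rfl v w; rfl
  exact this _ (inv_mul_cancel x) _ _

lemma leftTriv_mulInvariantVectorField (v : GroupLieAlgebra I G) (x : G) :
    leftTriv (mulInvariantVectorField v) x = v := by
  have h : (fun y : G => x⁻¹ * y) ∘ (fun y : G => x * y) = id := by ext y; simp
  have hd : ∀ a b : G, MDifferentiableAt I I (fun y : G => a * y) b := fun a b =>
    (contMDiff_mul_left (I := I) (n := ∞)).mdifferentiableAt (by simp)
  have h1 : mfderiv I I ((fun y : G => x⁻¹ * y) ∘ (fun y : G => x * y)) 1 v = v := by
    rw [h, mfderiv_id]; rfl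
  rw [mfderiv_comp (I' := I) 1 (hd _ _) (hd _ _)] at h1
  have : ∀ (b : G) (_ : b = x * 1) (w : E),
      (mfderiv I I (fun y : G => x⁻¹ * y) b : E → E) w =
        (mfderiv I I (fun y : G => x⁻¹ * y) (x * 1) : E → E) w := by
    rintro b rfl w; rfl
  exact (this x (mul_one x).symm _).trans h1

lemma mulInvariantVectorField_leftTriv (X : VField I G) (x : G) :
    mulInvariantVectorField (I := I) (G := G) (leftTriv (E := E) (I := I) X x) x = X x := by
  have h : (fun y : G => x * y) ∘ (fun y : G => x⁻¹ * y) = id := by ext y; simp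
  have hd : ∀ a b : G, MDifferentiableAt I I (fun y : G => a * y) b := fun a b =>
    (contMDiff_mul_left (I := I) (n := ∞)).mdifferentiableAt (by simp)
  have h1 : mfderiv I I ((fun y : G => x * y) ∘ (fun y : G => x⁻¹ * y)) x (X x) = X x := by
    rw [h, mfderiv_id]; rfl
  rw [mfderiv_comp (I' := I) x (hd _ _) (hd _ _)] at h1
  have : ∀ (b : G) (_ : b = x⁻¹ * x) (w : E),
      (mfderiv I I (fun y : G => x * y) b : E → E) w =
        (mfderiv I I (fun y : G => x * y) (x⁻¹ * x) : E → E) w := by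
    rintro b rfl w; rfl
  exact (this 1 (inv_mul_cancel x).symm _).trans h1

omit [LieGroup I ∞ G] in
/-- A left-invariant field of endomorphisms maps left-invariant vector fields to left-invariant
vector fields. -/
lemma EndField.LeftInvariant.app_mulInvariantVectorField {J : EndField I G} (hJ : J.LeftInvariant)
    (v : GroupLieAlgebra I G) :
    J.app (mulInvariantVectorField v) = mulInvariantVectorField (J 1 v) := by
  funext x
  have : ∀ (b : G) (_ : b = x * 1) (w : E), (J b : E → E) w = (J (x * 1) : E → E) w := by
    rintro b rfl w; rfl
  exact (this x (mul_one x).symm _).trans (hJ x 1 v)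

lemma bracket_mulInvariantVectorField [CompleteSpace E] (v w : GroupLieAlgebra I G) :
    bracket (mulInvariantVectorField v : VField I G) (mulInvariantVectorField w) =
      mulInvariantVectorField ⁅v, w⁆ :=
  (mulInvariantVector_mlieBracket v w).symm

omit [Group G] [LieGroup I ∞ G] in
lemma lieDer_const (X : VField I G) (c : ℝ) (x : G) : lieDer X (fun _ => c) x = 0 := by
  unfold lieDer
  rw [mfderiv_const]; rfl

/-- A field of bilinear forms, viewed as a function of two vector fields. -/
def BilinField.toForm2 (β : BilinField I G) : Form2 I G := fun X Y x => β x (X x) (Y x)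

lemma BilinField.LeftInvariant.toForm2_mulInvariantVectorField {β : BilinField I G}
    (hβ : β.LeftInvariant) (v w : GroupLieAlgebra I G) (x : G) :
    β.toForm2 (mulInvariantVectorField v) (mulInvariantVectorField w) x = β 1 v w := by
  rw [BilinField.toForm2, hβ.apply_eq, leftTriv_mulInvariantVectorField,
    leftTriv_mulInvariantVectorField]; rfl

lemma BilinField.LeftInvariant.mdifferentiableAt [FiniteDimensional ℝ E] {β : BilinField I G}
    (hβ : β.LeftInvariant) {X Y : VField I G} {p : G}
    (hX : MDifferentiableAt I I.tangent (fun x => (⟨x, X x⟩ : TangentBundle I G)) p)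
    (hY : MDifferentiableAt I I.tangent (fun x => (⟨x, Y x⟩ : TangentBundle I G)) p) :
    MDifferentiableAt I 𝓘(ℝ, ℝ) (β.toForm2 X Y) p := by
  let B : E →L[ℝ] E →L[ℝ] ℝ :=
    LinearMap.toContinuousLinearMap (LinearMap.toContinuousLinearMap.toLinearMap ∘ₗ β.atOne)
  have h : β.toForm2 X Y = fun x => B (leftTriv X x) (leftTriv Y x) :=
    funext fun x => hβ.apply_eq X Y x
  rw [h]
  exact (B.differentiableAt.comp_mdifferentiableAt (mdifferentiableAt_leftTriv hX)).clm_apply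
    (mdifferentiableAt_leftTriv hY)

end LieGeom

end

/-! ### Tensoriality of the exterior derivative of an invariant 2-form. -/

open scoped Manifold ContDiff

noncomputable section

namespace LieGeom

open VectorField Bundle

variable {E : Type*} [NormedAddCommGroup E] [NormedSpace ℝ E]
  {H : Type*} [TopologicalSpace H] {I : ModelWithCorners ℝ E H}
  {G : Type*} [TopologicalSpace G] [ChartedSpace H G]

section Form2

variable (β : BilinField I G)

lemma BilinField.toForm2_add_left (X X' Y : VField I G) :
    β.toForm2 (X + X') Y = fun x => β.toForm2 X Y x + β.toForm2 X' Y x := by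
  funext x; simp [toForm2]

lemma BilinField.toForm2_smul_left (f : G → ℝ) (X Y : VField I G) :
    β.toForm2 (f • X) Y = fun x => f x * β.toForm2 X Y x := by
  funext x; simp [toForm2]

lemma lieDer_add_field (X X' : VField I G) (f : G → ℝ) (x : G) :
    lieDer (X + X') f x = lieDer X f x + lieDer X' f x :=
  map_add (mfderiv I 𝓘(ℝ, ℝ) f x) (X x) (X' x)

lemma lieDer_smul_field (h : G → ℝ) (X : VField I G) (f : G → ℝ) (x : G) :
    lieDer (h • X) f x = h x * lieDer X f x :=
  map_smul (mfderiv I 𝓘(ℝ, ℝ) f x) (h x) (X x)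

lemma lieDer_add (X : VField I G) {f h : G → ℝ} {x : G} (hf : MDifferentiableAt I 𝓘(ℝ, ℝ) f x)
    (hh : MDifferentiableAt I 𝓘(ℝ, ℝ) h x) :
    lieDer X (fun y => f y + h y) x = lieDer X f x + lieDer X h x :=
  congrArg (fun L : TangentSpace I x →L[ℝ] ℝ => L (X x)) (mvfderiv_add hf hh)

lemma lieDer_mul (X : VField I G) {f h : G → ℝ} {x : G} (hf : MDifferentiableAt I 𝓘(ℝ, ℝ) f x)
    (hh : MDifferentiableAt I 𝓘(ℝ, ℝ) h x) :
    lieDer X (fun y => f y * h y) x = f x * lieDer X h x + h x * lieDer X f x :=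
  congrArg (fun L : TangentSpace I x →L[ℝ] ℝ => L (X x)) (mvfderiv_mul hf hh)

lemma lieDer_neg (X : VField I G) (f : G → ℝ) (x : G) :
    lieDer X (fun y => -f y) x = -lieDer X f x :=
  congrArg (fun L : TangentSpace I x →L[ℝ] ℝ => L (X x)) (mvfderiv_neg (g := f))

variable {β} (hβ : ∀ x v w, β x v w = -β x w v)
include hβ

lemma BilinField.toForm2_swap (X Y : VField I G) :
    β.toForm2 X Y = fun x => -β.toForm2 Y X x :=
  funext fun _ => hβ _ _ _

lemma extDer2_toForm2_swap_left (X Y Z : VField I G) (x : G) :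
    extDer2 β.toForm2 Y X Z x = -extDer2 β.toForm2 X Y Z x := by
  have h : bracket Y X = -bracket X Y := mlieBracket_swap
  have h' : β.toForm2 (-bracket X Y) Z x = -β.toForm2 (bracket X Y) Z x := by
    simp [BilinField.toForm2]
  simp only [extDer2]
  rw [h, h', BilinField.toForm2_swap hβ Y X, lieDer_neg]
  ring

lemma extDer2_toForm2_swap_right (X Y Z : VField I G) (x : G) :
    extDer2 β.toForm2 X Z Y x = -extDer2 β.toForm2 X Y Z x := by
  have h : bracket Z Y = -bracket Y Z := mlieBracket_swap
  have h' : β.toForm2 (-bracket Y Z) X x = -β.toForm2 (bracket Y Z) X x := by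
    simp [BilinField.toForm2]
  simp only [extDer2]
  rw [h, h', BilinField.toForm2_swap hβ Z Y, lieDer_neg]
  ring

end Form2

variable [Group G] [LieGroup I ∞ G] [FiniteDimensional ℝ E] [CompleteSpace E]

/-- The derivatives of f produced by the Leibniz rule cancel those produced by the brackets.
Tensoriality is what carries closedness from invariant fields to all smooth fields. -/
lemma tensorialAt_extDer2_toForm2 {β : BilinField I G} (hl : β.LeftInvariant) {Y Z : VField I G}
    {p : G}
    (hY : MDifferentiableAt I I.tangent (fun x => (⟨x, Y x⟩ : TangentBundle I G)) p)
    (hZ : MDifferentiableAt I I.tangent (fun x => (⟨x, Z x⟩ : TangentBundle I G)) p) :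
    TensorialAt I E (fun X : VField I G => extDer2 β.toForm2 X Y Z p) p where
  smul {f X} hf hX := by
    have e : ∀ W : VField I G, bracket (f • X) W p =
        -(lieDer W f p) • X p + f p • bracket X W p := fun W => by
      have := mlieBracket_smul_left (W := W) hf hX
      exact this
    have e' : ∀ W W' : VField I G, β.toForm2 (bracket (f • X) W) W' p =
        -(lieDer W f p) * β.toForm2 X W' p + f p * β.toForm2 (bracket X W) W' p := fun W W' => by
      simp only [BilinField.toForm2]
      rw [e, map_add, map_smul, map_smul]; rfl
    have e'' : ∀ W : VField I G, β.toForm2 W (f • X) p = f p * β.toForm2 W X p := fun W => by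
      simp [BilinField.toForm2]
    simp only [extDer2]
    rw [β.toForm2_smul_left, β.toForm2_smul_left, lieDer_smul_field,
      lieDer_mul _ hf (hl.mdifferentiableAt hX hZ), lieDer_mul _ hf (hl.mdifferentiableAt hX hY),
      e', e', e'', smul_eq_mul]
    ring
  add {X X'} hX hX' := by
    have e : ∀ W : VField I G, bracket (X + X') W p = bracket X W p + bracket X' W p := fun W =>
      mlieBracket_add_left hX hX'
    have e' : ∀ W W' : VField I G, β.toForm2 (bracket (X + X') W) W' p =
        β.toForm2 (bracket X W) W' p + β.toForm2 (bracket X' W) W' p := fun W W' => by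
      simp only [BilinField.toForm2]
      rw [e, map_add]; rfl
    have e'' : ∀ W : VField I G, β.toForm2 W (X + X') p = β.toForm2 W X p + β.toForm2 W X' p :=
      fun W => by simp [BilinField.toForm2]
    simp only [extDer2]
    rw [β.toForm2_add_left, β.toForm2_add_left, lieDer_add_field,
      lieDer_add _ (hl.mdifferentiableAt hX hZ) (hl.mdifferentiableAt hX' hZ),
      lieDer_add _ (hl.mdifferentiableAt hX hY) (hl.mdifferentiableAt hX' hY), e', e', e'']
    ring

omit [FiniteDimensional ℝ E] in
lemma extDer2_toForm2_mulInvariantVectorField {β : BilinField I G} (hl : β.LeftInvariant)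
    (u v w : GroupLieAlgebra I G) (x : G) :
    extDer2 β.toForm2 (mulInvariantVectorField u) (mulInvariantVectorField v)
        (mulInvariantVectorField w) x =
      -β 1 ⁅u, v⁆ w + β 1 ⁅u, w⁆ v - β 1 ⁅v, w⁆ u := by
  have h : ∀ a b : GroupLieAlgebra I G, β.toForm2 (mulInvariantVectorField a)
      (mulInvariantVectorField b) = fun _ => β 1 a b := fun a b =>
    funext fun x => hl.toForm2_mulInvariantVectorField a b x
  simp only [extDer2, bracket_mulInvariantVectorField, h, lieDer_const]
  ring

/-- The exterior derivative of a left-invariant `2`-form is given by the Chevalley–Eilenberg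
formula in the left trivialization. -/
lemma extDer2_toForm2_eq {β : BilinField I G} (hl : β.LeftInvariant)
    (hβ : ∀ x v w, β x v w = -β x w v) {X Y Z : VField I G} (hX : IsSmooth X) (hY : IsSmooth Y)
    (hZ : IsSmooth Z) (p : G) :
    ∃ u v w : GroupLieAlgebra I G, extDer2 β.toForm2 X Y Z p =
      -β 1 ⁅u, v⁆ w + β 1 ⁅u, w⁆ v - β 1 ⁅v, w⁆ u := by
  have hd : ∀ {W : VField I G}, IsSmooth W →
      MDifferentiableAt I I.tangent (fun x => (⟨x, W x⟩ : TangentBundle I G)) p := fun h =>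
    (ContMDiff.mdifferentiable h (by simp)) p
  -- Only the first slot is replaced, by the invariant field with the same value at p; antisymmetry
  -- brings the other slots there in turn.
  have key : ∀ {W Y Z : VField I G}, IsSmooth W → IsSmooth Y → IsSmooth Z →
      ∃ u : GroupLieAlgebra I G,
        extDer2 β.toForm2 W Y Z p = extDer2 β.toForm2 (mulInvariantVectorField u) Y Z p := by
    intro W Y Z hW hY hZ
    refine ⟨leftTriv (E := E) (I := I) W p, ?_⟩
    exact (tensorialAt_extDer2_toForm2 hl (hd hY) (hd hZ)).pointwise (hd hW)
      (hd (isSmooth_mulInvariantVectorField _)) (mulInvariantVectorField_leftTriv W p).symm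
  obtain ⟨u, hu⟩ := key hX hY hZ
  have hu' := isSmooth_mulInvariantVectorField u
  obtain ⟨v, hv⟩ := key hY hu' hZ
  have hv' := isSmooth_mulInvariantVectorField v
  obtain ⟨w, hw⟩ := key hZ hu' hv'
  refine ⟨u, v, w, ?_⟩
  rw [← extDer2_toForm2_mulInvariantVectorField hl u v w p, hu,
    ← neg_neg (extDer2 β.toForm2 _ Y Z p), ← extDer2_toForm2_swap_left hβ, hv,
    ← extDer2_toForm2_swap_left hβ, extDer2_toForm2_swap_right hβ,
    extDer2_toForm2_swap_left hβ, neg_neg, hw, extDer2_toForm2_swap_left hβ,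
    ← extDer2_toForm2_swap_right hβ, extDer2_toForm2_swap_left hβ]

end LieGeom

end

/-! ### Passage from the group to its Lie algebra, and conclusion. -/

open scoped Manifold ContDiff

noncomputable section

namespace AlmostAbelian

variable {V : Type*} [LieRing V] [LieAlgebra ℝ V]

/-- An abelian ideal of codimension one has a unit normal vector. -/
lemma exists_unit_normal [FiniteDimensional ℝ V] (g : V →ₗ[ℝ] V →ₗ[ℝ] ℝ)
    (pos : ∀ x, x ≠ 0 → 0 < g x x) (𝔥 : LieIdeal ℝ V) [IsLieAbelian 𝔥]
    (hdim : Module.finrank ℝ 𝔥 + 1 = Module.finrank ℝ V) :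
    ∃ n : V, g n n = 1 ∧ (∀ x y : V, g n x = 0 → g n y = 0 → ⁅x, y⁆ = 0) ∧
      ∀ x y : V, g n ⁅x, y⁆ = 0 := by
  let S : Submodule ℝ V := 𝔥.toSubmodule
  have hS : Module.finrank ℝ S + 1 = Module.finrank ℝ V := hdim
  -- The kernel of Φ is the orthogonal complement of the ideal, nonzero by dimension count.
  let Φ : V →ₗ[ℝ] Module.Dual ℝ S := (Module.Dual.transpose S.subtype) ∘ₗ g
  have hΦ : LinearMap.ker Φ ≠ ⊥ := LinearMap.ker_ne_bot_of_finrank_lt (by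
    rw [Subspace.dual_finrank_eq]; omega)
  obtain ⟨m, hm, hm0⟩ := (Submodule.ne_bot_iff _).1 hΦ
  have hmS : ∀ x ∈ S, g m x = 0 := fun x hx =>
    congrArg (fun L : Module.Dual ℝ S => L ⟨x, hx⟩) (LinearMap.mem_ker.1 hm)
  have hpos := pos m hm0
  have hle : S ≤ LinearMap.ker (g m) := fun x hx => LinearMap.mem_ker.2 (hmS x hx)
  have hlt : Module.finrank ℝ (LinearMap.ker (g m)) < Module.finrank ℝ V := by
    apply Submodule.finrank_lt
    intro h
    have : m ∈ LinearMap.ker (g m) := h ▸ Submodule.mem_top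
    exact hpos.ne' (LinearMap.mem_ker.1 this)
  have heq : S = LinearMap.ker (g m) := Submodule.eq_of_le_of_finrank_le hle (by omega)
  have hmem : ∀ x, g m x = 0 → x ∈ 𝔥 := fun x hx => by
    have : x ∈ S := heq ▸ LinearMap.mem_ker.2 hx
    exact this
  have hideal : ∀ x y : V, g m ⁅x, y⁆ = 0 := by
    intro x y
    -- Modulo the ideal every vector is a multiple of m, and [m, m] = 0; so all brackets lie in the
    -- ideal.
    have h1 : ∀ z, z - (g m z / g m m) • m ∈ 𝔥 := fun z => hmem _ (by
      simp [div_mul_cancel₀ _ hpos.ne'])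
    have h2 : g m ⁅x, y - (g m y / g m m) • m⁆ = 0 := hmS _ (lie_mem_right ℝ V 𝔥 _ _ (h1 y))
    have h3 : g m ⁅m, x - (g m x / g m m) • m⁆ = 0 := hmS _ (lie_mem_right ℝ V 𝔥 _ _ (h1 x))
    rw [← lie_skew] at h3
    simp only [lie_sub, sub_lie, lie_smul, smul_lie, lie_self, map_sub, map_smul, map_neg,
      smul_zero, sub_zero, neg_eq_zero] at h2 h3
    rw [h3] at h2
    simpa using h2
  have hs : Real.sqrt (g m m) ≠ 0 := (Real.sqrt_pos.2 hpos).ne'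
  refine ⟨(Real.sqrt (g m m))⁻¹ • m, ?_, ?_, ?_⟩
  · have := Real.mul_self_sqrt hpos.le
    simp only [map_smul, LinearMap.smul_apply, smul_eq_mul]
    field_simp
    rw [sq, this]
  · intro x y hx hy
    have h : ∀ z, g ((Real.sqrt (g m m))⁻¹ • m) z = 0 → z ∈ 𝔥 := fun z hz => hmem z (by
      simpa [hs] using hz)
    have := congrArg Subtype.val (trivial_lie_zero 𝔥 𝔥 ⟨x, h x hx⟩ ⟨y, h y hy⟩)
    exact this
  · intro x y
    simp [hideal]

end AlmostAbelian

namespace LieGeom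

open VectorField AlmostAbelian

variable {E : Type*} [NormedAddCommGroup E] [NormedSpace ℝ E]
  {H : Type*} [TopologicalSpace H] {I : ModelWithCorners ℝ E H}
  {G : Type*} [TopologicalSpace G] [ChartedSpace H G] [Group G] [LieGroup I ∞ G]
  {J : EndField I G} {g : BilinField I G}

lemma IsLeftInvHermitian.leftInvariant_fundForm (h : IsLeftInvHermitian J g) :
    BilinField.LeftInvariant (fun x => g x ∘ₗ J x) := by
  intro a x v w
  simp only [LinearMap.comp_apply]
  rw [h.complex.leftInv, h.metric.leftInv]

lemma IsLeftInvHermitian.fundForm_skew (h : IsLeftInvHermitian J g) (x : G)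
    (v w : TangentSpace I x) : (g x ∘ₗ J x) v w = -(g x ∘ₗ J x) w v := by
  simp only [LinearMap.comp_apply]
  rw [← h.compat x (J x v) w, h.complex.sq, map_neg, LinearMap.neg_apply, h.metric.symm]

variable [CompleteSpace E]

lemma IsLeftInvHermitian.dcFundForm_mulInvariantVectorField (h : IsLeftInvHermitian J g)
    (u v w : GroupLieAlgebra I G) :
    dcFundForm J g (mulInvariantVectorField u) (mulInvariantVectorField v)
      (mulInvariantVectorField w) = fun _ =>
        torsion (V := GroupLieAlgebra I G) (g 1) (J 1) u v w := by
  funext x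
  have := extDer2_toForm2_mulInvariantVectorField h.leftInvariant_fundForm (J 1 u) (J 1 v) (J 1 w) x
  simp only [dcFundForm, h.complex.leftInv.app_mulInvariantVectorField]
  exact congrArg Neg.neg this

lemma IsLeftInvSKT.dTorsion_eq_zero (h : IsLeftInvSKT J g) (u v w z : GroupLieAlgebra I G) :
    dTorsion (V := GroupLieAlgebra I G) (g 1) (J 1) u v w z = 0 := by
  have := congrFun (h.pluriclosed _ _ _ _ (isSmooth_mulInvariantVectorField u)
    (isSmooth_mulInvariantVectorField v) (isSmooth_mulInvariantVectorField w)
    (isSmooth_mulInvariantVectorField z)) 1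
  simp only [extDer3, bracket_mulInvariantVectorField,
    h.hermitian.dcFundForm_mulInvariantVectorField, lieDer_const] at this
  rw [dTorsion]
  simpa using this

lemma IsLeftInvHermitian.isHermitianWithNormal (h : IsLeftInvHermitian J g)
    {n : GroupLieAlgebra I G} (hn : g 1 n n = 1)
    (hc : ∀ x y : GroupLieAlgebra I G, g 1 n x = 0 → g 1 n y = 0 → ⁅x, y⁆ = 0)
    (hi : ∀ x y : GroupLieAlgebra I G, g 1 n ⁅x, y⁆ = 0) :
    IsHermitianWithNormal (V := GroupLieAlgebra I G) (g 1) (J 1) n where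
  symm := h.metric.symm 1
  pos := h.metric.pos 1
  sq := h.complex.sq 1
  compat := h.compat 1
  integrable u v := by
    have := congrFun (h.complex.integrable _ _ (isSmooth_mulInvariantVectorField u)
      (isSmooth_mulInvariantVectorField v)) 1
    simp only [nijenhuis, h.complex.leftInv.app_mulInvariantVectorField] at this
    exact this
  unit := hn
  comm := hc
  ideal := hi

lemma IsLeftInvHermitian.isLeftInvKahler [FiniteDimensional ℝ E] (h : IsLeftInvHermitian J g)
    (hd : ∀ u v w, dform (V := GroupLieAlgebra I G) (g 1) (J 1) u v w = 0) :
    IsLeftInvKahler J g where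
  hermitian := h
  closed X Y Z hX hY hZ := by
    funext p
    obtain ⟨u, v, w, huvw⟩ := extDer2_toForm2_eq h.leftInvariant_fundForm h.fundForm_skew hX hY hZ p
    exact huvw.trans (hd u v w)

-- Every tangent vector at x is the value of an invariant field, on which both structures act
-- through their values at 1.
omit [CompleteSpace E] in
lemma EndField.LeftInvariant.commutator_eq_zero {J K : EndField I G} (hJ : J.LeftInvariant)
    (hK : K.LeftInvariant) (h : ∀ v, J 1 (K 1 v) = K 1 (J 1 v)) : commutator J K = 0 := by
  funext x
  ext v
  have key : ∀ u : GroupLieAlgebra I G, J.app (K.app (mulInvariantVectorField u)) =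
      K.app (J.app (mulInvariantVectorField u)) := fun u => by
    rw [hJ.app_mulInvariantVectorField, hK.app_mulInvariantVectorField,
      hJ.app_mulInvariantVectorField, hK.app_mulInvariantVectorField, h]
  have e := congrFun (key (leftTriv (E := E) (I := I) (fun _ => (v : E)) x)) x
  simp only [EndField.app] at e
  rw [mulInvariantVectorField_leftTriv (fun _ => (v : E)) x] at e
  simp [commutator, e]

/-- A left-invariant generalized Kähler structure on a six-dimensional almost abelian Lie group is
split, unless its first Hermitian structure is Kähler. -/
theorem IsLeftInvGenKahler.isLeftInvKahler_or_commutator_eq_zero [FiniteDimensional ℝ E]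
    {Jp Jm : EndField I G} (hE : Module.finrank ℝ E = 6) (hG : IsAlmostAbelian I G)
    (h : IsLeftInvGenKahler Jp Jm g) : IsLeftInvKahler Jp g ∨ commutator Jp Jm = 0 := by
  obtain ⟨𝔥, h𝔥, hdim⟩ := hG
  have hfin : FiniteDimensional ℝ (GroupLieAlgebra I G) := inferInstanceAs (FiniteDimensional ℝ E)
  have hp := h.skt_plus.hermitian
  have hm := h.skt_minus.hermitian
  obtain ⟨n, hn, hc, hi⟩ := exists_unit_normal (V := GroupLieAlgebra I G) (g 1)
    (hp.metric.pos 1) 𝔥 hdim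
  have HJ := hp.isHermitianWithNormal hn hc hi
  have HK := hm.isHermitianWithNormal hn hc hi
  have ht : ∀ x y z : GroupLieAlgebra I G,
      AlmostAbelian.torsion (V := GroupLieAlgebra I G) (g 1) (Jp 1) x y z +
        AlmostAbelian.torsion (V := GroupLieAlgebra I G) (g 1) (Jm 1) x y z = 0 := by
    intro x y z
    have := congrFun (h.torsion _ _ _ (isSmooth_mulInvariantVectorField x)
      (isSmooth_mulInvariantVectorField y) (isSmooth_mulInvariantVectorField z)) 1
    rw [hp.dcFundForm_mulInvariantVectorField, hm.dcFundForm_mulInvariantVectorField] at this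
    exact this
  rcases IsHermitianWithNormal.dform_eq_zero_or_comm HJ HK hE ht h.skt_plus.dTorsion_eq_zero
    h.skt_minus.dTorsion_eq_zero with hd | hd
  · exact Or.inl (hp.isLeftInvKahler hd)
  · exact Or.inr (hp.complex.leftInv.commutator_eq_zero hm.complex.leftInv hd)

end LieGeom

end

theorem theorem5p1 {G : Type*} [TopologicalSpace G]
    [ChartedSpace (EuclideanSpace ℝ (Fin 6)) G] [Group G] [LieGroup (𝓡 6) ∞ G]
    (hG : LieGeom.IsAlmostAbelian (𝓡 6) G)
    (hK : ¬ ∃ (J : LieGeom.EndField (𝓡 6) G) (g : LieGeom.BilinField (𝓡 6) G),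
      LieGeom.IsLeftInvKahler J g) :
    (¬ ∃ (Jp Jm : LieGeom.EndField (𝓡 6) G) (g : LieGeom.BilinField (𝓡 6) G),
      LieGeom.IsLeftInvGenKahler Jp Jm g ∧ LieGeom.commutator Jp Jm ≠ 0) ∧
    (∀ (Jp Jm : LieGeom.EndField (𝓡 6) G) (g : LieGeom.BilinField (𝓡 6) G),
      LieGeom.IsLeftInvGenKahler Jp Jm g → LieGeom.commutator Jp Jm = 0) := by
  have key : ∀ (Jp Jm : LieGeom.EndField (𝓡 6) G) (g : LieGeom.BilinField (𝓡 6) G),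
      LieGeom.IsLeftInvGenKahler Jp Jm g → LieGeom.commutator Jp Jm = 0 := fun Jp Jm g h =>
    (h.isLeftInvKahler_or_commutator_eq_zero (by simp) hG).resolve_left fun h' => hK ⟨Jp, g, h'⟩
  exact ⟨fun ⟨Jp, Jm, g, h, hne⟩ => hne (key Jp Jm g h), key⟩
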